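/- Let $q$ be a complex number with $|q|<1$. Then the two series below converge absolutely and $$\sum_{n\ge1}\frac{q^n}{1+q^{2n-1}}=q\Bigl(\sum_{n\ge0}q^{n(n+1)}\Bigr)^2 .$$ The left-hand side is, for $|q|<1$, the sum of its Taylor series in $q$ at $0$. Write $[q^k]$ for the coefficient of $q^k$ in that series. For an integer $r\ge0$ let $t(r)$ be the number of ordered pairs $(x,y)$ of triangular numbers with $x+y=r$, where the triangular numbers are the integers $m(m+1)/2$ with $m\ge0$ (so $0$ is one of them). Then for every integer $r\ge0$, $$[q^{2r+1}]\sum_{n\ge1}\frac{q^n}{1+q^{2n-1}}=t(r).$$ -/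

import Mathlib

namespace LambertTriangular

noncomputable section

/-- The series `∑_{n ≥ 1} q ^ n / (1 + q ^ (2 n - 1))`; the term with index `n` here is the term
with index `n + 1` there. The denominators do not vanish for `‖q‖ < 1`. -/
def lambertSum (q : ℂ) : ℂ :=
  ∑' n : ℕ, q ^ (n + 1) / (1 + q ^ (2 * n + 1))

/-- The coefficient `[q ^ k] f` of the Taylor expansion of `f` at the origin. -/
def qCoeff (k : ℕ) (f : ℂ → ℂ) : ℂ :=
  iteratedDeriv k f 0 / (k.factorial : ℂ)

/-- The triangular numbers `n (n + 1) / 2` for `n ≥ 0`, so that `0` is one of them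
(the division is exact). -/
def IsTriangular (x : ℕ) : Prop :=
  ∃ n : ℕ, x = n * (n + 1) / 2

/-- The number of ordered pairs of triangular numbers with sum `r`
(a finite set, so that `Set.ncard` is its cardinality). -/
def triangularPairs (r : ℕ) : ℕ :=
  Set.ncard {p : ℕ × ℕ | IsTriangular p.1 ∧ IsTriangular p.2 ∧ p.1 + p.2 = r}

end

end LambertTriangular

namespace LambertTriangular

/-! Take out a factor `q` and expand each term geometrically: `q^n / (1 + q^(2n+1)) = ∑_k (-1)^k
q^(n + k(2n+1))`. The exponent `m` satisfies `2m+1 = (2n+1)(2k+1)`, and `(-1)^k = χ₄(2k+1)`, so the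
coefficient of `q^m` is `chiSum (2m+1)` (`sum_factorPairs`). By Jacobi's two-square theorem
(`ncard_normSet_eq`) this is a quarter of the number of Gaussian integers of norm `2m+1`. That
number is zero for odd `m`. For `m = 2r` it is four times the number of triangular pairs with sum
`r` (`ncard_normSet_four_mul_add_one`), and these pairs are counted by the squared series.

The two-square theorem is an induction on odd `n`: both `f = chiSum` and a quarter of the norm count
satisfy `f(pn) + χ₄(p) f(n/p) = (1 + χ₄(p)) f(n)`, with `f(n/p)` read as `0` when `p ∤ n`. -/

/-! ### Counting Gaussian integers by norm -/

/-- The Gaussian integers of norm `n`. -/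
def normSet (n : ℕ) : Set GaussianInt := {z | z.norm = n}

/-- The sum `∑_{d ∣ n} χ₄ d`. -/
def chiSum (n : ℕ) : ℤ := ∑ d ∈ n.divisors, ZMod.χ₄ (d : ZMod 4)

lemma gaussianInt_norm_eq (z : GaussianInt) : z.norm = z.re * z.re + z.im * z.im := by
  rw [Zsqrtd.norm_def]; ring

lemma finite_normSet (n : ℕ) : (normSet n).Finite := by
  refine Set.Finite.subset (((Set.finite_Icc (-(n : ℤ)) n).prod
    (Set.finite_Icc (-(n : ℤ)) n)).image (fun p : ℤ × ℤ => (⟨p.1, p.2⟩ : GaussianInt))) ?_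
  intro z hz
  have h : z.re * z.re + z.im * z.im = n := by rw [← gaussianInt_norm_eq]; exact hz
  refine ⟨(z.re, z.im), ⟨⟨?_, ?_⟩, ?_, ?_⟩, rfl⟩ <;> simp only <;>
    nlinarith [sq_nonneg z.re, sq_nonneg z.im, Int.le_self_sq z.re, Int.le_self_sq (-z.re),
      Int.le_self_sq z.im, Int.le_self_sq (-z.im)]

/-- The elements of norm `m * n` divisible by `w`, where `w` has norm `m`. -/
lemma ncard_normSet_mul_dvd {w : GaussianInt} {m : ℕ} (hm : 0 < m) (hw : w.norm = m) (n : ℕ) :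
    (normSet (m * n) ∩ {z | w ∣ z}).ncard = (normSet n).ncard := by
  have hw0 : w ≠ 0 := by
    rintro rfl
    simp at hw
    omega
  have : normSet (m * n) ∩ {z | w ∣ z} = (fun z => w * z) '' normSet n := by
    ext z
    constructor
    · rintro ⟨hz, u, rfl⟩
      refine ⟨u, ?_, rfl⟩
      simp only [normSet, Set.mem_ofPred_eq, Zsqrtd.norm_mul, hw, Nat.cast_mul] at hz ⊢
      exact mul_left_cancel₀ (by positivity) hz
    · rintro ⟨u, hu, rfl⟩
      refine ⟨?_, u, rfl⟩
      simp only [normSet, Set.mem_ofPred_eq, Zsqrtd.norm_mul, hw, Nat.cast_mul] at hu ⊢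
      rw [hu]
  rw [this, Set.ncard_image_of_injective _ (mul_right_injective₀ hw0)]

lemma ncard_normSet_mul_natCast_dvd {p : ℕ} (hp : p.Prime) (n : ℕ) :
    (normSet (p * n) ∩ {z | (p : GaussianInt) ∣ z}).ncard =
      if p ∣ n then (normSet (n / p)).ncard else 0 := by
  split_ifs with h
  · obtain ⟨k, rfl⟩ := h
    rw [Nat.mul_div_cancel_left _ hp.pos, ← mul_assoc]
    exact ncard_normSet_mul_dvd (Nat.mul_pos hp.pos hp.pos) (by simp [Zsqrtd.norm_natCast]) k
  · rw [Set.ncard_eq_zero ((finite_normSet _).inter_of_left _), Set.eq_empty_iff_forall_notMem]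
    rintro z ⟨hz, u, rfl⟩
    simp only [normSet, Set.mem_ofPred_eq, Zsqrtd.norm_mul, Zsqrtd.norm_natCast, Nat.cast_mul,
      mul_assoc] at hz
    have := mul_left_cancel₀ (by exact_mod_cast hp.ne_zero) hz
    exact h (by exact_mod_cast Dvd.intro _ this)

lemma dvd_mul_star_of_mem_normSet {p n : ℕ} {z : GaussianInt} (hz : z ∈ normSet (p * n)) :
    (p : GaussianInt) ∣ z * star z := by
  rw [← Zsqrtd.norm_eq_mul_conj, show z.norm = _ from hz]
  push_cast
  exact Dvd.intro _ rfl

/-- Here `p` stays prime in `ℤ[i]` and divides `z * star z`, hence divides `z`. -/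
lemma ncard_normSet_mul_of_three {p : ℕ} (hp : p.Prime) (h3 : p % 4 = 3) (n : ℕ) :
    (normSet (p * n)).ncard = if p ∣ n then (normSet (n / p)).ncard else 0 := by
  have := Fact.mk hp
  rw [← ncard_normSet_mul_natCast_dvd hp]
  congr 1
  refine (Set.inter_eq_left.2 fun z hz => ?_).symm
  rcases (GaussianInt.prime_of_nat_prime_of_mod_four_eq_three p h3).dvd_or_dvd
    (dvd_mul_star_of_mem_normSet hz) with h | ⟨u, hu⟩
  · exact h
  · refine ⟨star u, ?_⟩
    rw [← star_star z, hu, star_mul, mul_comm]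
    simp

lemma prime_of_norm_prime {p : ℕ} (hp : p.Prime) {w : GaussianInt} (hw : w.norm = p) :
    Prime w := by
  rw [← irreducible_iff_prime]
  have hw' : w.norm.natAbs = p := by simp [hw]
  refine ⟨fun h => ?_, fun a b hab => ?_⟩
  · rw [← Zsqrtd.norm_eq_one_iff, hw'] at h
    exact hp.one_lt.ne' h
  · rw [← Zsqrtd.norm_eq_one_iff, ← Zsqrtd.norm_eq_one_iff]
    rw [hab, Zsqrtd.norm_mul, Int.natAbs_mul] at hw'
    rw [← hw'] at hp
    rcases Nat.prime_mul_iff.1 hp with h | h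
    · exact Or.inr h.2
    · exact Or.inl h.2

/-- Inclusion–exclusion: `p = w * star w` splits, every `z` of norm `p * n` is divisible by `w` or
`star w`, and by both exactly when `p ∣ z`. -/
lemma ncard_normSet_mul_of_one {p : ℕ} (hp : p.Prime) (h1 : p % 4 = 1) (n : ℕ) :
    (normSet (p * n)).ncard + (if p ∣ n then (normSet (n / p)).ncard else 0) =
      2 * (normSet n).ncard := by
  have := Fact.mk hp
  obtain ⟨a, b, hab⟩ := Nat.Prime.sq_add_sq (p := p) (by omega)
  let w : GaussianInt := ⟨a, b⟩
  have hw : w.norm = p := by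
    rw [gaussianInt_norm_eq, ← hab]; push_cast; ring
  have hw' : (star w).norm = p := by rw [Zsqrtd.norm_conj, hw]
  have hmul : (p : GaussianInt) = w * star w := by
    rw [← Zsqrtd.norm_eq_mul_conj, hw]; simp
  have hP := prime_of_norm_prime hp hw
  have hP' := prime_of_norm_prime hp hw'
  -- Otherwise `star w` divides `w + star w = 2a`; taking norms, `p ∣ 4a²`, so `p` divides `a`, then
  -- `b`, and `p² ∣ a² + b² = p`.
  have hnd : ¬ star w ∣ w := by
    intro h
    have h2 : star w ∣ ((2 * a : ℤ) : GaussianInt) := by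
      have : ((2 * a : ℤ) : GaussianInt) = w + star w := by
        ext <;> simp [w, two_mul]
      rw [this]
      exact dvd_add h dvd_rfl
    obtain ⟨u, hu⟩ := h2
    have h3 := congrArg Zsqrtd.norm hu
    rw [Zsqrtd.norm_mul, hw', Zsqrtd.norm_intCast] at h3
    have h4 : p ∣ (2 * a) * (2 * a) := by
      have : (p : ℤ) ∣ ((2 * a * (2 * a) : ℕ) : ℤ) := ⟨u.norm, by push_cast; exact h3⟩
      exact_mod_cast this
    have h5 : p ∣ 2 * a := by
      rcases hp.dvd_mul.1 h4 with h | h <;> exact h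
    have h6 : p ∣ a := by
      rcases hp.dvd_mul.1 h5 with h | h
      · have := Nat.le_of_dvd (by norm_num) h
        interval_cases p <;> omega
      · exact h
    have h7 : p ∣ b ^ 2 := by
      rw [← Nat.dvd_add_right (dvd_pow h6 two_ne_zero), hab]
    have h8 := hp.dvd_of_dvd_pow h7
    have h9 : p ^ 2 ∣ p := by
      conv_rhs => rw [← hab]
      exact dvd_add (pow_dvd_pow_of_dvd h6 2) (pow_dvd_pow_of_dvd h8 2)
    have := Nat.le_of_dvd hp.pos h9
    nlinarith [hp.two_le]
  have hunion : normSet (p * n) ∩ {z | w ∣ z} ∪ normSet (p * n) ∩ {z | star w ∣ z} =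
      normSet (p * n) := by
    rw [← Set.inter_union_distrib_left, Set.inter_eq_left]
    intro z hz
    have h := (Dvd.intro _ hmul.symm).trans (dvd_mul_star_of_mem_normSet hz)
    rcases hP.dvd_or_dvd h with h | ⟨u, hu⟩
    · exact Or.inl h
    · refine Or.inr ⟨star u, ?_⟩
      rw [← star_star z, hu, star_mul, mul_comm]
  have hinter : (normSet (p * n) ∩ {z | w ∣ z}) ∩ (normSet (p * n) ∩ {z | star w ∣ z}) =
      normSet (p * n) ∩ {z | (p : GaussianInt) ∣ z} := by
    rw [← Set.inter_inter_distrib_left]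
    congr 1
    ext z
    constructor
    · rintro ⟨⟨u, rfl⟩, h⟩
      rcases hP'.dvd_or_dvd h with h | h
      · exact absurd h hnd
      · change (p : GaussianInt) ∣ w * u
        rw [hmul]
        exact mul_dvd_mul_left w h
    · intro h
      rw [Set.mem_ofPred_eq, hmul] at h
      exact ⟨(Dvd.intro _ rfl).trans h, (Dvd.intro_left _ rfl).trans h⟩
  have key := Set.ncard_union_add_ncard_inter (normSet (p * n) ∩ {z | w ∣ z})
    (normSet (p * n) ∩ {z | star w ∣ z}) ((finite_normSet _).inter_of_left _)
    ((finite_normSet _).inter_of_left _)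
  rw [hunion, hinter, ncard_normSet_mul_natCast_dvd hp, ncard_normSet_mul_dvd hp.pos hw,
    ncard_normSet_mul_dvd hp.pos hw'] at key
  rw [key, two_mul]

/-! ### Divisor sums of `χ₄` and the two-square theorem -/

lemma divisors_prime_mul {p : ℕ} (hp : p.Prime) {n : ℕ} (hn : n ≠ 0) :
    (p * n).divisors = n.divisors ∪ n.divisors.image (p * ·) := by
  rw [Nat.divisors_mul, hp.divisors]
  ext d
  simp [Finset.mem_mul, hn]

lemma divisors_inter_image_mul {p : ℕ} (hp : p.Prime) {n : ℕ} (hn : n ≠ 0) :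
    n.divisors ∩ n.divisors.image (p * ·) =
      if p ∣ n then (n / p).divisors.image (p * ·) else ∅ := by
  split_ifs with h
  · obtain ⟨k, rfl⟩ := h
    rw [Nat.mul_div_cancel_left _ hp.pos]
    ext d
    simp only [Finset.mem_inter, Nat.mem_divisors, Finset.mem_image]
    constructor
    · rintro ⟨⟨h1, h2⟩, e, -, rfl⟩
      exact ⟨e, ⟨Nat.dvd_of_mul_dvd_mul_left hp.pos h1, right_ne_zero_of_mul h2⟩, rfl⟩
    · rintro ⟨e, ⟨h1, h2⟩, rfl⟩
      exact ⟨⟨mul_dvd_mul_left p h1, hn⟩, e, ⟨h1.mul_left p, hn⟩, rfl⟩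
  · rw [Finset.eq_empty_iff_forall_notMem]
    intro d hd
    simp only [Finset.mem_inter, Nat.mem_divisors, Finset.mem_image] at hd
    obtain ⟨⟨h1, -⟩, e, -, rfl⟩ := hd
    exact h ((Dvd.intro _ rfl).trans h1)

lemma sum_image_prime_mul {p : ℕ} (hp : p.Prime) (n : ℕ) :
    ∑ d ∈ n.divisors.image (p * ·), ZMod.χ₄ (d : ZMod 4) = ZMod.χ₄ (p : ZMod 4) * chiSum n := by
  rw [Finset.sum_image fun a _ b _ h => Nat.eq_of_mul_eq_mul_left hp.pos h, chiSum,
    Finset.mul_sum]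
  simp only [Nat.cast_mul, map_mul]

lemma chiSum_prime_mul {p : ℕ} (hp : p.Prime) {n : ℕ} (hn : n ≠ 0) :
    chiSum (p * n) + ZMod.χ₄ (p : ZMod 4) * (if p ∣ n then chiSum (n / p) else 0) =
      (1 + ZMod.χ₄ (p : ZMod 4)) * chiSum n := by
  have h := Finset.sum_union_inter (s₁ := n.divisors) (s₂ := n.divisors.image (p * ·))
    (f := fun d : ℕ => ZMod.χ₄ (d : ZMod 4))
  rw [← divisors_prime_mul hp hn, divisors_inter_image_mul hp hn, sum_image_prime_mul hp] at h
  rw [add_mul, one_mul]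
  refine Eq.trans ?_ h
  rw [chiSum]
  congr 1
  split_ifs
  · rw [sum_image_prime_mul hp]
  · simp

lemma ncard_normSet_one : (normSet 1).ncard = 4 := by
  have : normSet 1 = (({⟨1, 0⟩, ⟨-1, 0⟩, ⟨0, 1⟩, ⟨0, -1⟩} : Finset GaussianInt) :
      Set GaussianInt) := by
    ext ⟨a, b⟩
    simp only [normSet, Set.mem_ofPred_eq, gaussianInt_norm_eq, Finset.coe_insert,
      Finset.coe_singleton, Set.mem_insert_iff, Set.mem_singleton_iff, Zsqrtd.ext_iff,
      Nat.cast_one]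
    constructor
    · intro h
      have h1 : -1 ≤ a := by nlinarith
      have h2 : a ≤ 1 := by nlinarith
      have h3 : -1 ≤ b := by nlinarith
      have h4 : b ≤ 1 := by nlinarith
      interval_cases a <;> interval_cases b <;> simp_all
    · rintro (⟨rfl, rfl⟩ | ⟨rfl, rfl⟩ | ⟨rfl, rfl⟩ | ⟨rfl, rfl⟩) <;> norm_num
  rw [this, Set.ncard_coe_finset]
  decide

/-- **Jacobi's two-square theorem** for odd numbers. -/
theorem ncard_normSet_eq {n : ℕ} (hn : Odd n) : ((normSet n).ncard : ℤ) = 4 * chiSum n := by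
  induction n using Nat.strong_induction_on with
  | _ n ih =>
  rcases eq_or_ne n 1 with rfl | h1
  · simp [ncard_normSet_one, chiSum]
  obtain ⟨p, hp, m, rfl⟩ := Nat.exists_prime_and_dvd h1
  obtain ⟨hpo, hmo⟩ := Nat.odd_mul.1 hn
  have hm := ih m (lt_mul_of_one_lt_left hmo.pos hp.one_lt) hmo
  have hk : ((if p ∣ m then (normSet (m / p)).ncard else 0 : ℕ) : ℤ) =
      4 * (if p ∣ m then chiSum (m / p) else 0) := by
    split_ifs with h
    · obtain ⟨k, rfl⟩ := h
      have hko := (Nat.odd_mul.1 hmo).2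
      rw [Nat.mul_div_cancel_left _ hp.pos]
      refine ih k ?_ hko
      exact (lt_mul_of_one_lt_left hko.pos hp.one_lt).trans
        (lt_mul_of_one_lt_left hmo.pos hp.one_lt)
    · simp
  have hS := chiSum_prime_mul hp hmo.pos.ne'
  rcases (by have := Nat.odd_iff.1 hpo; omega : p % 4 = 1 ∨ p % 4 = 3) with h | h
  · have hR := ncard_normSet_mul_of_one hp h m
    rw [ZMod.χ₄_nat_one_mod_four h] at hS
    have hR' := congrArg (Nat.cast : ℕ → ℤ) hR
    rw [Nat.cast_add, hk, Nat.cast_mul, Nat.cast_ofNat] at hR'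
    linarith
  · rw [ncard_normSet_mul_of_three hp h m, hk]
    rw [ZMod.χ₄_nat_three_mod_four h] at hS
    linarith

/-- A sum of two squares is never `3` modulo `4`, so the norm count vanishes. -/
lemma chiSum_of_three {n : ℕ} (hn : n % 4 = 3) : chiSum n = 0 := by
  have h := ncard_normSet_eq (n := n) (Nat.odd_iff.2 (by omega))
  have he : normSet n = ∅ := by
    rw [Set.eq_empty_iff_forall_notMem]
    rintro ⟨a, b⟩ hz
    simp only [normSet, Set.mem_ofPred_eq, gaussianInt_norm_eq] at hz
    have h4 := congrArg (fun t : ℤ => (t : ZMod 4)) hz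
    have h3 : ((n : ℤ) : ZMod 4) = 3 := by
      rw [Int.cast_natCast, ← ZMod.natCast_mod, hn]; rfl
    simp only [h3, Int.cast_add, Int.cast_mul] at h4
    revert h4
    generalize (a : ZMod 4) = x
    generalize (b : ZMod 4) = y
    revert x y
    decide
  rw [he] at h
  simpa using h.symm

/-! ### Triangular pairs and norms `4r + 1` -/

/-- Pairs `(a, b)` whose triangular numbers sum to `r`. -/
def indexPairs (r : ℕ) : Finset (ℕ × ℕ) :=
  (Finset.range (r + 1) ×ˢ Finset.range (r + 1)).filter
    fun p => p.1 * (p.1 + 1) / 2 + p.2 * (p.2 + 1) / 2 = r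

lemma le_triangle (a : ℕ) : a ≤ a * (a + 1) / 2 := by
  rw [Nat.le_div_iff_mul_le two_pos]
  rcases a with _ | a <;> nlinarith

lemma two_mul_triangle (a : ℕ) : 2 * (a * (a + 1) / 2) = a * (a + 1) :=
  Nat.mul_div_cancel' (Nat.even_mul_succ_self a).two_dvd

lemma triangle_injective : Function.Injective fun a : ℕ => a * (a + 1) / 2 := by
  intro a b h
  simp only at h
  have := two_mul_triangle a
  rw [h, two_mul_triangle] at this
  nlinarith [Nat.lt_trichotomy a b]

lemma mem_indexPairs {r : ℕ} {p : ℕ × ℕ} :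
    p ∈ indexPairs r ↔ p.1 * (p.1 + 1) / 2 + p.2 * (p.2 + 1) / 2 = r := by
  simp only [indexPairs, Finset.mem_filter, Finset.mem_product, Finset.mem_range]
  have := le_triangle p.1
  have := le_triangle p.2
  omega

lemma triangularPairs_eq (r : ℕ) : triangularPairs r = (indexPairs r).card := by
  rw [triangularPairs, ← Set.ncard_coe_finset, ← Set.ncard_image_of_injective
    (indexPairs r : Set (ℕ × ℕ)) (triangle_injective.prodMap triangle_injective)]
  congr 1
  ext ⟨x, y⟩
  simp only [Set.mem_ofPred_eq, Set.mem_image, Finset.mem_coe, mem_indexPairs, Prod.map, Prod.ext_iff]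
  constructor
  · rintro ⟨⟨a, rfl⟩, ⟨b, rfl⟩, h⟩
    exact ⟨(a, b), h, rfl, rfl⟩
  · rintro ⟨⟨a, b⟩, h, rfl, rfl⟩
    exact ⟨⟨a, rfl⟩, ⟨b, rfl⟩, h⟩

/-- The two integers `a` and `-1 - a` with the same value of `x * (x + 1)`. -/
def signed (s : Bool) (a : ℕ) : ℤ := if s then a else -1 - a

lemma signed_mul (s : Bool) (a : ℕ) : signed s a * (signed s a + 1) = (a * (a + 1) : ℕ) := by
  cases s <;> simp [signed] <;> ring

lemma signed_injective {s t : Bool} {a b : ℕ} (h : signed s a = signed t b) : s = t ∧ a = b := by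
  cases s <;> cases t <;> simp only [signed, if_true, Bool.false_eq_true, if_false, true_and, reduceCtorEq, false_and] at h ⊢ <;> omega

lemma exists_signed (x : ℤ) : ∃ s a, signed s a = x := by
  rcases le_or_gt 0 x with h | h
  · exact ⟨true, x.toNat, by simp [signed, h]⟩
  · exact ⟨false, (-1 - x).toNat, by simp [signed]; omega⟩

/-- From `(x+y+1)² + (x-y)² = 2x(x+1) + 2y(y+1) + 1`. Each of `x`, `y` may be replaced by its
reflection `-1 - x`, `-1 - y`, which gives the factor four. -/
lemma ncard_normSet_four_mul_add_one (r : ℕ) :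
    (normSet (4 * r + 1)).ncard = 4 * triangularPairs r := by
  let g : (Bool × Bool) × (ℕ × ℕ) → GaussianInt := fun p =>
    ⟨signed p.1.1 p.2.1 + signed p.1.2 p.2.2 + 1, signed p.1.1 p.2.1 - signed p.1.2 p.2.2⟩
  have hg : Function.Injective g := by
    rintro ⟨⟨s, t⟩, a, b⟩ ⟨⟨s', t'⟩, a', b'⟩ h
    simp only [g, Zsqrtd.ext_iff] at h
    obtain ⟨rfl, rfl⟩ := signed_injective (show signed s a = signed s' a' by omega)
    obtain ⟨rfl, rfl⟩ := signed_injective (show signed t b = signed t' b' by omega)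
    rfl
  have himage : normSet (4 * r + 1) = g '' (↑((Finset.univ : Finset (Bool × Bool)) ×ˢ indexPairs r)) := by
    have hnorm : ∀ p, (g p).norm = 4 * ((p.2.1 * (p.2.1 + 1) / 2 + p.2.2 * (p.2.2 + 1) / 2 : ℕ) : ℤ)
        + 1 := by
      intro p
      have h1 := signed_mul p.1.1 p.2.1
      have h2 := signed_mul p.1.2 p.2.2
      rw [← two_mul_triangle] at h1 h2
      rw [gaussianInt_norm_eq, Nat.cast_add]
      rw [Nat.cast_mul] at h1 h2
      simp only [g]
      linear_combination 2 * h1 + 2 * h2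
    ext z
    constructor
    · intro hz
      -- The norm is odd, so the halves `(re ± im - 1) / 2` that invert `g` are exact.
      have hpar : (z.re + z.im) % 2 = 1 := by
        have hz' : z.re * z.re + z.im * z.im = 4 * r + 1 := by
          rw [← gaussianInt_norm_eq]; exact_mod_cast hz
        rcases Int.emod_two_eq_zero_or_one z.re with h | h <;>
          rcases Int.emod_two_eq_zero_or_one z.im with h' | h' <;>
          have := congrArg (· % 2) hz' <;>
          simp [Int.add_emod, Int.mul_emod, h, h'] at this ⊢
      obtain ⟨s, a, ha⟩ := exists_signed ((z.re + z.im - 1) / 2)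
      obtain ⟨t, b, hb⟩ := exists_signed ((z.re - z.im - 1) / 2)
      have hgz : g ((s, t), (a, b)) = z := by
        simp only [g, ha, hb]
        ext <;> simp only <;> omega
      refine ⟨((s, t), (a, b)), ?_, hgz⟩
      simp only [Finset.coe_product, Set.mem_prod, Finset.coe_univ, Set.mem_univ, true_and,
        Finset.mem_coe, mem_indexPairs]
      have := hnorm ((s, t), (a, b))
      rw [hgz, show z.norm = _ from hz] at this
      simp only at this
      omega
    · rintro ⟨p, hp, rfl⟩
      simp only [Finset.coe_product, Set.mem_prod, Finset.coe_univ, Set.mem_univ, true_and,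
        Finset.mem_coe, mem_indexPairs] at hp
      change (g p).norm = _
      rw [hnorm, hp]
      push_cast
      ring
  rw [himage, Set.ncard_image_of_injective _ hg, Set.ncard_coe_finset, Finset.card_product,
    triangularPairs_eq]
  simp

lemma chiSum_four_mul_add_one (r : ℕ) : chiSum (4 * r + 1) = triangularPairs r := by
  have h := ncard_normSet_eq (n := 4 * r + 1) (Nat.odd_iff.2 (by omega))
  rw [ncard_normSet_four_mul_add_one] at h
  push_cast at h
  linarith


/-! ### The `q`-series -/

/-- Collecting the terms of a double series in `q` by their exponents. -/
lemma hasSum_collect {β : Type*} {a : β → ℂ} {g : β → ℕ} {F : ℕ → Finset β}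
    (hF : ∀ m b, b ∈ F m ↔ g b = m) {q s : ℂ} (h : HasSum (fun b => a b * q ^ g b) s) :
    HasSum (fun m => (∑ b ∈ F m, a b) * q ^ m) s := by
  refine (h.tsum_fiberwise g).congr_fun fun m => ?_
  have hm : g ⁻¹' {m} = (F m : Set β) := by
    ext b
    simp [hF]
  rw [hm, Finset.tsum_subtype' (F m) (fun b => a b * q ^ g b), Finset.sum_mul]
  exact Finset.sum_congr rfl fun b hb => by rw [(hF m b).1 hb]

lemma summable_lambert_double {q : ℂ} (hq : ‖q‖ < 1) :
    Summable fun p : ℕ × ℕ => (-1) ^ p.2 * q ^ (p.1 + p.2 * (2 * p.1 + 1)) := by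
  have hg := summable_geometric_of_lt_one (norm_nonneg q) hq
  refine Summable.of_norm_bounded (hg.mul_of_nonneg hg (fun n => by positivity)
    (fun n => by positivity)) fun p => ?_
  rw [norm_mul, norm_pow, norm_pow, norm_neg, norm_one, one_pow, one_mul, ← pow_add]
  -- The exponent is `n + k + 2nk ≥ n + k`, so a product of two geometric series dominates.
  exact pow_le_pow_of_le_one (norm_nonneg q) hq.le (by nlinarith [Nat.zero_le (p.2 * p.1)])

lemma hasSum_lambert_term {q : ℂ} (hq : ‖q‖ < 1) (n : ℕ) :
    HasSum (fun k : ℕ => (-1) ^ k * q ^ (n + k * (2 * n + 1))) (q ^ n / (1 + q ^ (2 * n + 1))) := by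
  have h1 : ‖-q ^ (2 * n + 1)‖ < 1 := by
    rw [norm_neg, norm_pow]
    exact pow_lt_one₀ (norm_nonneg q) hq (by omega)
  have h := (hasSum_geometric_of_norm_lt_one h1).mul_left (q ^ n)
  rw [sub_neg_eq_add, ← div_eq_mul_inv] at h
  refine h.congr_fun fun k => ?_
  rw [neg_pow (q ^ (2 * n + 1)), pow_add, ← pow_mul, mul_comm k, mul_left_comm]

/-- The pairs `(n, k)` with `n + k * (2 * n + 1) = m`. -/
def factorPairs (m : ℕ) : Finset (ℕ × ℕ) :=
  (Finset.range (m + 1) ×ˢ Finset.range (m + 1)).filter fun p => p.1 + p.2 * (2 * p.1 + 1) = m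

lemma mem_factorPairs (m : ℕ) (p : ℕ × ℕ) :
    p ∈ factorPairs m ↔ p.1 + p.2 * (2 * p.1 + 1) = m := by
  simp only [factorPairs, Finset.mem_filter, Finset.mem_product, Finset.mem_range,
    and_iff_right_iff_imp]
  rintro rfl
  constructor <;> nlinarith [Nat.zero_le (p.2 * p.1)]

lemma sum_factorPairs (m : ℕ) : ∑ p ∈ factorPairs m, (-1 : ℂ) ^ p.2 = chiSum (2 * m + 1) := by
  rw [chiSum, Int.cast_sum]
  refine Finset.sum_bij (fun p _ => 2 * p.2 + 1) ?_ ?_ ?_ ?_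
  · intro p hp
    rw [mem_factorPairs] at hp
    rw [Nat.mem_divisors]
    exact ⟨⟨2 * p.1 + 1, by rw [← hp]; ring⟩, by omega⟩
  · rintro ⟨n, k⟩ h ⟨n', k'⟩ h' hk
    rw [mem_factorPairs] at h h'
    obtain rfl : k = k' := by omega
    simp only [Prod.mk.injEq, and_true] at h h' ⊢
    nlinarith [Nat.lt_trichotomy n n']
  · intro d hd
    obtain ⟨e, he⟩ := (Nat.mem_divisors.1 hd).1
    have ho : Odd (d * e) := by rw [← he]; exact ⟨m, rfl⟩
    obtain ⟨⟨k, rfl⟩, n, rfl⟩ := Nat.odd_mul.1 ho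
    exact ⟨(n, k), (mem_factorPairs _ _).2 (by simp only; nlinarith), rfl⟩
  · intro p _
    rw [ZMod.χ₄_eq_neg_one_pow (by omega)]
    push_cast
    congr 1
    omega

lemma hasSum_lambert {q : ℂ} (hq : ‖q‖ < 1) :
    Summable (fun n : ℕ => q ^ n / (1 + q ^ (2 * n + 1))) ∧
    HasSum (fun m : ℕ => (chiSum (2 * m + 1) : ℂ) * q ^ m)
      (∑' n : ℕ, q ^ n / (1 + q ^ (2 * n + 1))) := by
  have h := (summable_lambert_double hq).hasSum
  have h1 := h.prod_fiberwise (hasSum_lambert_term hq)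
  refine ⟨h1.summable, ?_⟩
  rw [h1.tsum_eq]
  simpa only [sum_factorPairs] using hasSum_collect mem_factorPairs h

lemma lambert_term (q : ℂ) (n : ℕ) :
    q ^ (n + 1) / (1 + q ^ (2 * n + 1)) = q * (q ^ n / (1 + q ^ (2 * n + 1))) := by
  rw [pow_succ', mul_div_assoc]

lemma lambertSum_eq (q : ℂ) :
    lambertSum q = q * ∑' n : ℕ, q ^ n / (1 + q ^ (2 * n + 1)) := by
  simp only [lambertSum, lambert_term, tsum_mul_left]

lemma summable_triangular {q : ℂ} (hq : ‖q‖ < 1) :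
    Summable fun n : ℕ => ‖q ^ (n * (n + 1))‖ := by
  refine Summable.of_nonneg_of_le (fun n => norm_nonneg _) (fun n => ?_)
    (summable_geometric_of_lt_one (norm_nonneg q) hq)
  rw [norm_pow]
  exact pow_le_pow_of_le_one (norm_nonneg q) hq.le (by nlinarith [Nat.zero_le (n * n)])

lemma hasSum_triangular_sq {q : ℂ} (hq : ‖q‖ < 1) :
    HasSum (fun r : ℕ => (triangularPairs r : ℂ) * q ^ (2 * r))
      ((∑' n : ℕ, q ^ (n * (n + 1))) ^ 2) := by
  have hs := summable_triangular hq
  have h := (summable_mul_of_summable_norm hs hs).hasSum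
  rw [← tsum_mul_tsum_of_summable_norm hs hs, ← sq] at h
  have h2 : HasSum (fun p : ℕ × ℕ => 1 * (q ^ 2) ^ (p.1 * (p.1 + 1) / 2 + p.2 * (p.2 + 1) / 2))
      ((∑' n : ℕ, q ^ (n * (n + 1))) ^ 2) := by
    refine h.congr_fun fun p => ?_
    rw [one_mul, ← pow_mul, mul_add, two_mul_triangle, two_mul_triangle, pow_add]
  have h3 := hasSum_collect (fun _ _ => mem_indexPairs) h2
  simpa [triangularPairs_eq, pow_mul] using h3

lemma tsum_lambert_eq {q : ℂ} (hq : ‖q‖ < 1) :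
    ∑' n : ℕ, q ^ n / (1 + q ^ (2 * n + 1)) = (∑' n : ℕ, q ^ (n * (n + 1))) ^ 2 := by
  refine (hasSum_lambert hq).2.unique ?_
  -- The `0` is the sum over odd `m`, where `2m+1` is `3` modulo `4`.
  rw [← add_zero ((∑' n : ℕ, q ^ (n * (n + 1))) ^ 2)]
  refine HasSum.even_add_odd ?_ ?_
  · refine (hasSum_triangular_sq hq).congr_fun fun r => ?_
    rw [← mul_assoc, show 2 * 2 = 4 from rfl, chiSum_four_mul_add_one, Int.cast_natCast]
  · refine hasSum_zero.congr_fun fun r => ?_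
    rw [chiSum_of_three (by omega), Int.cast_zero, zero_mul]

/-! ### Taylor coefficients -/

/-- The Taylor coefficients of `lambertSum` at the origin. -/
def lambertCoeff : ℕ → ℂ
  | 0 => 0
  | m + 1 => chiSum (2 * m + 1)

lemma hasSum_lambertCoeff {q : ℂ} (hq : ‖q‖ < 1) :
    HasSum (fun k => lambertCoeff k * q ^ k) (lambertSum q) := by
  rw [← hasSum_nat_add_iff' 1, lambertSum_eq]
  simp only [Finset.range_one, Finset.sum_singleton, lambertCoeff, zero_mul, sub_zero]
  refine ((hasSum_lambert hq).2.mul_left q).congr_fun fun m => ?_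
  ring

lemma hasFPowerSeriesOnBall_ofScalars {c : ℕ → ℂ} {f : ℂ → ℂ}
    (h : ∀ q : ℂ, ‖q‖ < 1 → HasSum (fun k => c k * q ^ k) (f q)) :
    HasFPowerSeriesOnBall f (FormalMultilinearSeries.ofScalars ℂ c) 0 1 := by
  constructor
  · refine le_of_forall_lt_imp_le_of_dense fun r hr => ?_
    lift r to NNReal using hr.ne_top
    apply FormalMultilinearSeries.le_radius_of_summable
    simpa using (h r (by simpa using hr)).summable.norm
  · simp
  · intro y hy
    rw [← ENNReal.coe_one, Metric.eball_coe, NNReal.coe_one, mem_ball_zero_iff] at hy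
    simpa [mul_comm] using h y hy

/-- Uniqueness of the power series at the origin. -/
lemma qCoeff_eq {c : ℕ → ℂ} {f : ℂ → ℂ}
    (h : ∀ q : ℂ, ‖q‖ < 1 → HasSum (fun k => c k * q ^ k) (f q)) (k : ℕ) :
    qCoeff k f = c k := by
  have hf := (hasFPowerSeriesOnBall_ofScalars h).hasFPowerSeriesAt
  have he := hf.analyticAt.hasFPowerSeriesAt.eq_formalMultilinearSeries hf
  simpa [qCoeff, FormalMultilinearSeries.coeff_ofScalars] using
    congrArg (fun p => FormalMultilinearSeries.coeff p k) he

end LambertTriangular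

theorem proposition5p10 :
    (∀ q : ℂ, ‖q‖ < 1 →
      Summable (fun n : ℕ => q ^ (n + 1) / (1 + q ^ (2 * n + 1))) ∧
      Summable (fun n : ℕ => q ^ (n * (n + 1))) ∧
      LambertTriangular.lambertSum q = q * (∑' n : ℕ, q ^ (n * (n + 1))) ^ 2) ∧
    (∀ q : ℂ, ‖q‖ < 1 →
      HasSum (fun k : ℕ => LambertTriangular.qCoeff k LambertTriangular.lambertSum * q ^ k)
        (LambertTriangular.lambertSum q)) ∧
    (∀ r : ℕ, LambertTriangular.qCoeff (2 * r + 1) LambertTriangular.lambertSum =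
      (LambertTriangular.triangularPairs r : ℂ)) := by
  have hc := LambertTriangular.qCoeff_eq fun _ => LambertTriangular.hasSum_lambertCoeff
  refine ⟨fun q hq => ⟨?_, (LambertTriangular.summable_triangular hq).of_norm, ?_⟩,
    fun q hq => ?_, fun r => ?_⟩
  · simp only [LambertTriangular.lambert_term]
    exact (LambertTriangular.hasSum_lambert hq).1.mul_left q
  · rw [LambertTriangular.lambertSum_eq, LambertTriangular.tsum_lambert_eq hq]
  · simpa only [hc] using LambertTriangular.hasSum_lambertCoeff hq
  · rw [hc, LambertTriangular.lambertCoeff, ← mul_assoc, show 2 * 2 = 4 from rfl,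
      LambertTriangular.chiSum_four_mul_add_one, Int.cast_natCast]
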